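/- Consider a networked dynamic system (NDS) with $N$ subsystems. Let $\delta(\cdot)$ denote either the time derivative or the forward time shift. For $i=1,\dots,N$, subsystem $i$ has state $x(t,i)$, external input $u(t,i)$ and output $y(t,i)$, internal input $v(t,i)$ and output $z(t,i)$ (all finite-dimensional and real), and is described by $$\begin{bmatrix}E^{[0]}(i)\,\delta(x(t,i))\\ z(t,i)\\ y(t,i)\end{bmatrix}=\left\{\begin{bmatrix}A^{[0]}_{xx}(i)&A^{[0]}_{xv}(i)&B^{[0]}_{x}(i)\\A^{[0]}_{zx}(i)&A^{[0]}_{zv}(i)&B^{[0]}_{z}(i)\\C^{[0]}_{x}(i)&C^{[0]}_{v}(i)&D^{[0]}(i)\end{bmatrix}+\begin{bmatrix}H_1(i)\\H_2(i)\\H_3(i)\end{bmatrix}P(i)\,[I-G(i)P(i)]^{-1}\begin{bmatrix}F_1(i)&F_2(i)&F_3(i)\end{bmatrix}\right\}\begin{bmatrix}x(t,i)\\v(t,i)\\u(t,i)\end{bmatrix},$$ where all matrices are real and constant and $E^{[0]}(i)$ is square, possibly singular. The subsystems are connected by $v(t)=\Phi z(t)$, where $v(t)=\mathrm{col}\{v(t,i)\}_{i=1}^N$,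 $z(t)=\mathrm{col}\{z(t,i)\}_{i=1}^N$, and $\Phi$ has blocks $\Phi_{ij}$. Put $$E=\mathrm{diag}\{E^{[0]}(i)\},\quad A_{xx}=\mathrm{diag}\{A^{[0]}_{xx}(i)\},\quad A_{xv}=\mathrm{diag}\{[A^{[0]}_{xv}(i)\ \ H_1(i)]\},\quad A_{zx}=\mathrm{diag}\left\{\begin{bmatrix}A^{[0]}_{zx}(i)\\F_1(i)\end{bmatrix}\right\},$$ $$A_{zv}=\mathrm{diag}\left\{\begin{bmatrix}A^{[0]}_{zv}(i)&H_2(i)\\F_2(i)&G(i)\end{bmatrix}\right\},\quad C_x=\mathrm{diag}\{C^{[0]}_x(i)\},\quad C_v=\mathrm{diag}\{[C^{[0]}_v(i)\ \ H_3(i)]\},$$ and let $\bar\Phi$ be the block matrix whose $(i,j)$ block is $\mathrm{diag}\{\Phi_{ii},P(i)\}$ if $i=j$ and $\mathrm{diag}\{\Phi_{ij},0\}$ if $i\neq j$. Assume that every subsystem is well-posed, i.e. $I-G(i)P(i)$ is invertible for each $i$, and that the NDS is well-posed, i.e. $I-\Phi\tilde A_{zv}$ is invertible, where $\tilde A_{zv}=\mathrm{diag}\{A^{[0]}_{zv}(i)+H_2(i)P(i)[I-G(i)P(i)]^{-1}F_2(i)\}$.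 Assume further that the NDS is regular: $\det(\lambda E-A)\neq0$ for some $\lambda\in\mathbb C$, where $A=A_{xx}+A_{xv}\bar\Phi[I-A_{zv}\bar\Phi]^{-1}A_{zx}$. The NDS is called completely observable if its states are uniquely determined by its external inputs and outputs over the whole time interval, in the following sense. In continuous time, the initial state $x(0^-)$ is arbitrary (possibly inconsistent), the signals on $[0,\infty)$ are real distributions supported in $[0,\infty)$, with the derivative of $x$ on $[0,\infty)$ including the impulse due to the jump at time $0$ (that is, $\delta(x)=\dot x-x(0^-)\delta_0$, with $\dot x$ the distributional derivative of $x$ and $\delta_0$ the Dirac distribution), and $x(0^-)$ has to be uniquely determined by the external inputs and outputs at $0^-$ and on $[0,\infty)$; here the equations for $z$, $y$ and $v$ hold also at $0^-$. In discrete time, for every sufficiently large $T$, the states $x(0),\dots,x(T)$ of every trajectory on $\{0,\dots,T\}$ have to be uniquely determined by the external inputs and outputs on $\{0,\dots,T\}$. Then the NDS is completely observable if and only if the following two conditions hold: 1. the matrix $M^{[d]}_\infty=\begin{bmatrix}E&0\\-C_x&-C_v\\-\bar\Phi A_{zx}&I-\bar\Phi A_{zv}\end{bmatrix}$ is of full column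 rank; 2. the matrix $M^{[d]}(\lambda)=\begin{bmatrix}\lambda E-A_{xx}&-A_{xv}\\-C_x&-C_v\\-\bar\Phi A_{zx}&I-\bar\Phi A_{zv}\end{bmatrix}$ is of full column rank for every $\lambda\in\mathbb C$. -/

import Mathlib

open scoped Matrix Distributions LineDeriv

noncomputable section

/-- The data of a networked dynamic system (NDS) with `N` descriptor-form subsystems.  Subsystem
`i` has a state `x(t,i)`, external input `u(t,i)`, internal input `v(t,i)`, external output
`y(t,i)` and internal output `z(t,i)`, of dimensions `mx i`, `mu i`, `mv i`, `my i`, `mz i`;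
`P i` is the matrix of its parameters, of size `mp i × mq i`; `Phi` is the subsystem connection
matrix, `v(t) = Phi z(t)`.  The matrix `E0 i` may be singular. -/
structure DescriptorNDS where
  N : ℕ
  mx : Fin N → ℕ
  mu : Fin N → ℕ
  mv : Fin N → ℕ
  my : Fin N → ℕ
  mz : Fin N → ℕ
  mp : Fin N → ℕ
  mq : Fin N → ℕ
  E0 : (i : Fin N) → Matrix (Fin (mx i)) (Fin (mx i)) ℝ
  Axx0 : (i : Fin N) → Matrix (Fin (mx i)) (Fin (mx i)) ℝ
  Axv0 : (i : Fin N) → Matrix (Fin (mx i)) (Fin (mv i)) ℝ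
  Bx0 : (i : Fin N) → Matrix (Fin (mx i)) (Fin (mu i)) ℝ
  Azx0 : (i : Fin N) → Matrix (Fin (mz i)) (Fin (mx i)) ℝ
  Azv0 : (i : Fin N) → Matrix (Fin (mz i)) (Fin (mv i)) ℝ
  Bz0 : (i : Fin N) → Matrix (Fin (mz i)) (Fin (mu i)) ℝ
  Cx0 : (i : Fin N) → Matrix (Fin (my i)) (Fin (mx i)) ℝ
  Cv0 : (i : Fin N) → Matrix (Fin (my i)) (Fin (mv i)) ℝ
  D0 : (i : Fin N) → Matrix (Fin (my i)) (Fin (mu i)) ℝ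
  H1 : (i : Fin N) → Matrix (Fin (mx i)) (Fin (mp i)) ℝ
  H2 : (i : Fin N) → Matrix (Fin (mz i)) (Fin (mp i)) ℝ
  H3 : (i : Fin N) → Matrix (Fin (my i)) (Fin (mp i)) ℝ
  P : (i : Fin N) → Matrix (Fin (mp i)) (Fin (mq i)) ℝ
  G : (i : Fin N) → Matrix (Fin (mq i)) (Fin (mp i)) ℝ
  F1 : (i : Fin N) → Matrix (Fin (mq i)) (Fin (mx i)) ℝ
  F2 : (i : Fin N) → Matrix (Fin (mq i)) (Fin (mv i)) ℝ
  F3 : (i : Fin N) → Matrix (Fin (mq i)) (Fin (mu i)) ℝ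
  Phi : Matrix (Σ i, Fin (mv i)) (Σ i, Fin (mz i)) ℝ

/-- Whether `δ` is the derivative with respect to time or the forward time shift. -/
inductive TimeDomain where
  | continuous
  | discrete

/-- A real matrix applied to a vector whose entries lie in a real vector space `V` (real numbers,
or distributions on the time axis). -/
def Matrix.act {m n V : Type*} [Fintype n] [AddCommGroup V] [Module ℝ V]
    (M : Matrix m n ℝ) (w : n → V) : m → V :=
  fun i => ∑ j, M i j • w j

/-- A matrix is of full column rank. -/
def Matrix.IsFCR {m n K : Type*} [Fintype n] [Field K] (M : Matrix m n K) : Prop :=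
  M.rank = Fintype.card n

namespace DescriptorNDS

variable (S : DescriptorNDS)

/-- Indices of the entries of `x(t) = col{x(t,i)}`. -/
abbrev X : Type := Σ i, Fin (S.mx i)
/-- Indices of the entries of `u(t)`. -/
abbrev U : Type := Σ i, Fin (S.mu i)
/-- Indices of the entries of `v(t)`. -/
abbrev V : Type := Σ i, Fin (S.mv i)
/-- Indices of the entries of `y(t)`. -/
abbrev Y : Type := Σ i, Fin (S.my i)
/-- Indices of the entries of `z(t)`. -/
abbrev Z : Type := Σ i, Fin (S.mz i)

/-! ### The matrices of a subsystem, as linear fractional transformations of `P i` -/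

/-- The factor `P(i) [I - G(i) P(i)]⁻¹`. -/
def lft (i : Fin S.N) : Matrix (Fin (S.mp i)) (Fin (S.mq i)) ℝ :=
  S.P i * (1 - S.G i * S.P i)⁻¹

def subAxx (i : Fin S.N) : Matrix (Fin (S.mx i)) (Fin (S.mx i)) ℝ :=
  S.Axx0 i + S.H1 i * S.lft i * S.F1 i
def subAxv (i : Fin S.N) : Matrix (Fin (S.mx i)) (Fin (S.mv i)) ℝ :=
  S.Axv0 i + S.H1 i * S.lft i * S.F2 i
def subBx (i : Fin S.N) : Matrix (Fin (S.mx i)) (Fin (S.mu i)) ℝ :=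
  S.Bx0 i + S.H1 i * S.lft i * S.F3 i
def subAzx (i : Fin S.N) : Matrix (Fin (S.mz i)) (Fin (S.mx i)) ℝ :=
  S.Azx0 i + S.H2 i * S.lft i * S.F1 i
def subAzv (i : Fin S.N) : Matrix (Fin (S.mz i)) (Fin (S.mv i)) ℝ :=
  S.Azv0 i + S.H2 i * S.lft i * S.F2 i
def subBz (i : Fin S.N) : Matrix (Fin (S.mz i)) (Fin (S.mu i)) ℝ :=
  S.Bz0 i + S.H2 i * S.lft i * S.F3 i
def subCx (i : Fin S.N) : Matrix (Fin (S.my i)) (Fin (S.mx i)) ℝ :=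
  S.Cx0 i + S.H3 i * S.lft i * S.F1 i
def subCv (i : Fin S.N) : Matrix (Fin (S.my i)) (Fin (S.mv i)) ℝ :=
  S.Cv0 i + S.H3 i * S.lft i * S.F2 i
def subD (i : Fin S.N) : Matrix (Fin (S.my i)) (Fin (S.mu i)) ℝ :=
  S.D0 i + S.H3 i * S.lft i * S.F3 i

/-! ### Well-posedness -/

/-- Every subsystem is well-posed: `I - G(i) P(i)` is invertible. -/
def SubsystemsWellPosed : Prop :=
  ∀ i, IsUnit (1 - S.G i * S.P i)

/-- The interconnection of the subsystems is well-posed: the algebraic loop formed by the internal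
inputs and outputs of the subsystems and `v = Φ z` is uniquely solvable. -/
def WellPosed : Prop :=
  IsUnit (1 - S.Phi * Matrix.blockDiagonal' S.subAzv)

/-! ### The augmented representation -/

/-- Indices of the entries of the augmented internal input `v̄(t)`, `v̄(t,i) = col{v, vᵃ}`. -/
abbrev Vbar : Type := Σ i, (Fin (S.mv i) ⊕ Fin (S.mp i))
/-- Indices of the entries of the augmented internal output `z̄(t)`, `z̄(t,i) = col{z, zᵃ}`. -/
abbrev Zbar : Type := Σ i, (Fin (S.mz i) ⊕ Fin (S.mq i))

def E : Matrix S.X S.X ℝ := Matrix.blockDiagonal' S.E0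
def Axx : Matrix S.X S.X ℝ := Matrix.blockDiagonal' S.Axx0
def Axv : Matrix S.X S.Vbar ℝ :=
  Matrix.blockDiagonal' fun i => Matrix.fromCols (S.Axv0 i) (S.H1 i)
def Azx : Matrix S.Zbar S.X ℝ :=
  Matrix.blockDiagonal' fun i => Matrix.fromRows (S.Azx0 i) (S.F1 i)
def Azv : Matrix S.Zbar S.Vbar ℝ :=
  Matrix.blockDiagonal' fun i => Matrix.fromBlocks (S.Azv0 i) (S.H2 i) (S.F2 i) (S.G i)
def Cx : Matrix S.Y S.X ℝ := Matrix.blockDiagonal' S.Cx0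
def Cv : Matrix S.Y S.Vbar ℝ :=
  Matrix.blockDiagonal' fun i => Matrix.fromCols (S.Cv0 i) (S.H3 i)

/-- The augmented subsystem connection matrix `Φ̄`: its `(i,j)` block is `diag{Φ_ij, P(i)}` for
`i = j` and `diag{Φ_ij, 0}` for `i ≠ j`. -/
def PhiBar : Matrix S.Vbar S.Zbar ℝ := Matrix.of fun a b =>
  match a, b with
  | ⟨i, Sum.inl k⟩, ⟨j, Sum.inl l⟩ => S.Phi ⟨i, k⟩ ⟨j, l⟩
  | ⟨i, Sum.inr k⟩, ⟨j, Sum.inr l⟩ => Matrix.blockDiagonal' S.P ⟨i, k⟩ ⟨j, l⟩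
  | ⟨_, Sum.inl _⟩, ⟨_, Sum.inr _⟩ => 0
  | ⟨_, Sum.inr _⟩, ⟨_, Sum.inl _⟩ => 0

/-- The state matrix `A` of the NDS as a descriptor system `E δ(x) = A x + B u`, obtained by
eliminating the internal signals. -/
def A : Matrix S.X S.X ℝ :=
  S.Axx + S.Axv * S.PhiBar * (1 - S.Azv * S.PhiBar)⁻¹ * S.Azx

/-- The NDS is regular: `det(λ E - A) ≠ 0` for some complex `λ`. -/
def IsRegular : Prop :=
  ∃ lam : ℂ, (lam • S.E.map Complex.ofReal - S.A.map Complex.ofReal).det ≠ 0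

/-- The matrix `M_∞ = [E, 0; -C_x, -C_v; -Φ̄ A_zx, I - Φ̄ A_zv]`. -/
def MInf : Matrix (S.X ⊕ (S.Y ⊕ S.Vbar)) (S.X ⊕ S.Vbar) ℝ :=
  Matrix.fromRows (Matrix.fromCols S.E 0)
    (Matrix.fromRows (Matrix.fromCols (-S.Cx) (-S.Cv))
      (Matrix.fromCols (-(S.PhiBar * S.Azx)) (1 - S.PhiBar * S.Azv)))

/-- The matrix pencil
`M(λ) = [λ E - A_xx, -A_xv; -C_x, -C_v; -Φ̄ A_zx, I - Φ̄ A_zv]` at a complex `λ`. -/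
def MPencil (lam : ℂ) : Matrix (S.X ⊕ (S.Y ⊕ S.Vbar)) (S.X ⊕ S.Vbar) ℂ :=
  Matrix.fromRows
    (Matrix.fromCols (lam • S.E.map Complex.ofReal - S.Axx.map Complex.ofReal)
      (-(S.Axv.map Complex.ofReal)))
    (Matrix.fromRows
      (Matrix.fromCols (-(S.Cx.map Complex.ofReal)) (-(S.Cv.map Complex.ofReal)))
      (Matrix.fromCols (-((S.PhiBar * S.Azx).map Complex.ofReal))
        ((1 - S.PhiBar * S.Azv).map Complex.ofReal)))

/-! ### Signals and trajectories -/

section Signals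

variable {S} {W : Type*} [AddCommGroup W] [Module ℝ W]

/-- The algebraic equations of the NDS: for every subsystem the equations of its internal output
`z` and of its external output `y`, and the interconnection `v = Φ z`. -/
def AlgebraicEquations (x : S.X → W) (u : S.U → W) (v : S.V → W) (z : S.Z → W) (y : S.Y → W) :
    Prop :=
  (∀ i, (fun k => z ⟨i, k⟩) =
      (S.subAzx i).act (fun k => x ⟨i, k⟩) + (S.subAzv i).act (fun k => v ⟨i, k⟩) +
        (S.subBz i).act (fun k => u ⟨i, k⟩)) ∧
  (∀ i, (fun k => y ⟨i, k⟩) =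
      (S.subCx i).act (fun k => x ⟨i, k⟩) + (S.subCv i).act (fun k => v ⟨i, k⟩) +
        (S.subD i).act (fun k => u ⟨i, k⟩)) ∧
  v = S.Phi.act z

/-- The state equations `E⁽⁰⁾(i) δ(x(t,i)) = A_xx x(t,i) + A_xv v(t,i) + B_x u(t,i)` of all
subsystems, with `dx` in the role of `δ(x)`. -/
def StateEquations (dx x : S.X → W) (u : S.U → W) (v : S.V → W) : Prop :=
  ∀ i, (S.E0 i).act (fun k => dx ⟨i, k⟩) =
    (S.subAxx i).act (fun k => x ⟨i, k⟩) + (S.subAxv i).act (fun k => v ⟨i, k⟩) +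
      (S.subBx i).act (fun k => u ⟨i, k⟩)

end Signals

/-- Real distributions on the time axis. -/
abbrev Dist : Type := 𝓓'((⊤ : TopologicalSpace.Opens ℝ), ℝ)

/-- The distribution `T` is supported in `[0, ∞)`. -/
def Causal (T : Dist) : Prop := Distribution.IsVanishingOn T (Set.Iio (0 : ℝ))

/-- Continuous time.  The initial state `x0 = x(0⁻)` is arbitrary (it need not be consistent), so
the signals on `[0, ∞)` are distributions, which may have impulses at `0`.  A signal consists of
its value at `0⁻` (`x0`, `u0`, ...) and of a distribution supported in `[0, ∞)` (`x`, `u`, ...);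
the derivative on `[0, ∞)` of such a signal includes the jump at time `0`, that is, it is
`∂x - x0 δ₀` with `∂` the distributional derivative and `δ₀` the Dirac distribution. -/
structure IsContinuousTrajectory
    (x0 : S.X → ℝ) (u0 : S.U → ℝ) (v0 : S.V → ℝ) (z0 : S.Z → ℝ) (y0 : S.Y → ℝ)
    (x : S.X → Dist) (u : S.U → Dist) (v : S.V → Dist) (z : S.Z → Dist) (y : S.Y → Dist) :
    Prop where
  causal_x : ∀ k, Causal (x k)
  causal_u : ∀ k, Causal (u k)
  causal_v : ∀ k, Causal (v k)
  causal_z : ∀ k, Causal (z k)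
  causal_y : ∀ k, Causal (y k)
  algebraic_init : AlgebraicEquations x0 u0 v0 z0 y0
  algebraic : AlgebraicEquations x u v z y
  state : StateEquations
    (fun k => ∂_{(1 : ℝ)} (x k) - x0 k • (Distribution.delta (0 : ℝ) : Dist)) x u v

/-- Discrete time, on the time interval `{0, 1, …, T}`: the algebraic equations hold for
`0 ≤ t ≤ T`, the state equations for `0 ≤ t < T`. -/
structure IsDiscreteTrajectory (T : ℕ)
    (x : ℕ → S.X → ℝ) (u : ℕ → S.U → ℝ) (v : ℕ → S.V → ℝ) (z : ℕ → S.Z → ℝ)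
    (y : ℕ → S.Y → ℝ) : Prop where
  algebraic : ∀ t ≤ T, AlgebraicEquations (x t) (u t) (v t) (z t) (y t)
  state : ∀ t < T, StateEquations (x (t + 1)) (x t) (u t) (v t)

/-- Complete observability.

In continuous time: the initial state `x(0⁻)`, arbitrary and possibly inconsistent, is uniquely
determined by the external inputs and outputs (their values at `0⁻` and the distributions on
`[0, ∞)`).

In discrete time: on every sufficiently long time interval `{0, …, T}` the states are uniquely
determined by the external inputs and outputs on that interval.  A descriptor system
is in general not causal in discrete time and its trajectories on `{0, …, T}` are fixed by boundary
data at both ends, which is why the states on the whole interval are to be determined. -/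
def CompletelyObservable : TimeDomain → Prop
  | .continuous =>
    ∀ x0 x0' u0 v0 v0' z0 z0' y0 x x' u v v' z z' y,
      S.IsContinuousTrajectory x0 u0 v0 z0 y0 x u v z y →
      S.IsContinuousTrajectory x0' u0 v0' z0' y0 x' u v' z' y →
      x0 = x0'
  | .discrete =>
    ∃ T₀ : ℕ, ∀ T ≥ T₀, ∀ x x' u u' v v' z z' y y',
      S.IsDiscreteTrajectory T x u v z y →
      S.IsDiscreteTrajectory T x' u' v' z' y' →
      (∀ t ≤ T, u t = u' t ∧ y t = y' t) →
      ∀ t ≤ T, x t = x' t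

end DescriptorNDS

end

/-! By linearity, complete observability says that a trajectory with zero external input and output
has zero initial state (continuous time) or vanishes on the whole interval (discrete time). On such
trajectories well-posedness eliminates the internal signals: what remains is `E δ(x) = A x`, `C x =
0` with `A = redA`, `C = redC`. The same elimination, run on the augmented loop, shows that the
kernel of `MInf` is `ker E ∩ ker C` and that of `MPencil λ` is `{x | A x = λ E x, C x = 0}`
(`mInf_isFCR_iff`, `mPencil_isFCR_iff`).

Necessity is by explicit trajectories. A vector of `ker E ∩ ker C` is an undetectable final state in
discrete time and an undetectable jump to zero in continuous time; an eigenvector `w` at `λ` gives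
the modes `λ ^ t w` and `e^{λ t} w`.

Sufficiency rests on `eq_bot_of_pencil_invariant`: if `K ⊆ ker C` and `A K ⊆ E K`, then `E` is
injective on `K`, so `A = E M` on `K` for an endomorphism `M`, and a complex eigenvector of `M`
would violate the finite rank condition; hence `K = 0`. In discrete time `K` is the stable value of
the decreasing chain of initial values of solutions on `{0, …, T}`.

In continuous time the argument is dual. The row vectors `r` for which `r x` is a combination of
derivatives of `δ₀` form a space whose annihilator is such a `K` (`eq_top_of_pencil_closed`), so `x
= q(∂) δ₀` for a polynomial vector `q`. Comparing coefficients from the top degree down gives `q =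
0`, hence `E x₀ = 0`; together with `C x₀ = 0` this gives `x₀ = 0`. -/

namespace Matrix

/-! ### Real matrices acting on vectors with entries in a real vector space. -/

section Act

variable {l m n V V' : Type*} [AddCommGroup V] [Module ℝ V] [AddCommGroup V'] [Module ℝ V']

theorem act_add [Fintype n] (M : Matrix m n ℝ) (w w' : n → V) :
    M.act (w + w') = M.act w + M.act w' := by
  ext i; simp [act, Finset.sum_add_distrib]

theorem act_sub [Fintype n] (M : Matrix m n ℝ) (w w' : n → V) :
    M.act (w - w') = M.act w - M.act w' := by
  ext i; simp [act, Finset.sum_sub_distrib, smul_sub]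

@[simp] theorem act_zero [Fintype n] (M : Matrix m n ℝ) : M.act (0 : n → V) = 0 := by
  ext i; simp [act]

theorem add_act [Fintype n] (M N : Matrix m n ℝ) (w : n → V) :
    (M + N).act w = M.act w + N.act w := by
  ext i; simp [act, Finset.sum_add_distrib, add_smul]

theorem sub_act [Fintype n] (M N : Matrix m n ℝ) (w : n → V) :
    (M - N).act w = M.act w - N.act w := by
  ext i; simp [act, Finset.sum_sub_distrib, sub_smul]

@[simp] theorem one_act [Fintype n] [DecidableEq n] (w : n → V) :
    (1 : Matrix n n ℝ).act w = w := by
  ext i; simp [act, Matrix.one_apply, ite_smul]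

theorem mul_act [Fintype m] [Fintype n] (M : Matrix l m ℝ) (N : Matrix m n ℝ) (w : n → V) :
    (M * N).act w = M.act (N.act w) := by
  ext i
  simp only [act, Matrix.mul_apply, Finset.sum_smul, Finset.smul_sum, mul_smul]
  exact Finset.sum_comm

theorem map_act [Fintype n] (L : V →ₗ[ℝ] V') (M : Matrix m n ℝ) (w : n → V) :
    M.act (fun j => L (w j)) = fun i => L (M.act w i) := by
  ext i; simp [act]

theorem act_eq_mulVec [Fintype n] (M : Matrix m n ℝ) (w : n → ℝ) : M.act w = M *ᵥ w := by
  ext i; simp [act, Matrix.mulVec, dotProduct]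

theorem act_eq_map_mulVec [Fintype n] (M : Matrix m n ℝ) (w : n → ℂ) :
    M.act w = M.map Complex.ofReal *ᵥ w := by
  ext i; simp [act, Matrix.mulVec, dotProduct]

theorem act_smul_complex [Fintype n] (M : Matrix m n ℝ) (c : ℂ) (w : n → ℂ) :
    M.act (c • w) = c • M.act w := by
  rw [act_eq_map_mulVec, act_eq_map_mulVec, Matrix.mulVec_smul]

theorem fromCols_act {n₁ n₂ : Type*} [Fintype n₁] [Fintype n₂] (M : Matrix m n₁ ℝ)
    (N : Matrix m n₂ ℝ) (w : n₁ ⊕ n₂ → V) :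
    (fromCols M N).act w = M.act (fun k => w (.inl k)) + N.act (fun k => w (.inr k)) := by
  ext i; simp [act]

theorem blockDiagonal'_act {ι : Type*} [Fintype ι] [DecidableEq ι] {r s : ι → Type*}
    [∀ i, Fintype (s i)] (M : ∀ i, Matrix (r i) (s i) ℝ) (w : (Σ i, s i) → V) (i : ι) (k : r i) :
    (blockDiagonal' M).act w ⟨i, k⟩ = (M i).act (fun j => w ⟨i, j⟩) k := by
  simp only [act, Fintype.sum_sigma]
  rw [Finset.sum_eq_single i]
  · simp [blockDiagonal'_apply_eq]
  · intro j _ hj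
    exact Finset.sum_eq_zero fun x _ => by rw [blockDiagonal'_apply_ne _ _ _ hj.symm, zero_smul]
  · simp

/-- An equation `w = M w + b` with `1 - M` invertible has the unique solution `(1 - M)⁻¹ b`. -/
theorem eq_act_add_iff [Fintype n] [DecidableEq n] {M : Matrix n n ℝ} (hM : IsUnit (1 - M))
    (w b : n → V) : w = b + M.act w ↔ w = (1 - M)⁻¹.act b := by
  have hdet := (Matrix.isUnit_iff_isUnit_det _).1 hM
  rw [← sub_eq_iff_eq_add]
  have h : w - M.act w = (1 - M).act w := by rw [sub_act, one_act]
  rw [h]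
  constructor
  · rintro rfl
    rw [← mul_act, Matrix.nonsing_inv_mul _ hdet, one_act]
  · rintro rfl
    rw [← mul_act, Matrix.mul_nonsing_inv _ hdet, one_act]

/-- The push-through identity for feedback loops: `a = P (b + G a)` is solved by
`a = P (1 - G P)⁻¹ b`. -/
theorem eq_act_feedback_iff [Fintype m] [Fintype n] [DecidableEq n]
    {P : Matrix m n ℝ} {G : Matrix n m ℝ} (h : IsUnit (1 - G * P)) (a : m → V) (b : n → V) :
    a = P.act (b + G.act a) ↔ a = (P * (1 - G * P)⁻¹).act b := by
  constructor
  · intro ha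
    -- The signal `q = b + G a` entering `P` satisfies `q = b + G P q`, which the invertibility of
    -- `1 - G P` solves.
    have hq : b + G.act a = b + (G * P).act (b + G.act a) := by
      rw [mul_act, ← ha]
    rw [eq_act_add_iff h] at hq
    rw [mul_act, ← hq, ← ha]
  · intro ha
    rw [mul_act] at ha
    set q := (1 - G * P)⁻¹.act b with hq
    rw [← eq_act_add_iff h] at hq
    rw [mul_act, ← ha] at hq
    rw [← hq, ← ha]

end Act

theorem isFCR_iff {m n K : Type*} [Fintype m] [Fintype n] [Field K] (M : Matrix m n K) :
    M.IsFCR ↔ ∀ w, M *ᵥ w = 0 → w = 0 := by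
  classical
  have h := LinearMap.finrank_range_add_finrank_ker M.mulVecLin
  rw [Module.finrank_fintype_fun_eq_card] at h
  have h2 : M.IsFCR ↔ LinearMap.ker M.mulVecLin = ⊥ := by
    unfold IsFCR Matrix.rank
    rw [← Submodule.finrank_eq_zero (R := K)]
    omega
  rw [h2, LinearMap.ker_eq_bot']
  rfl

end Matrix

/-! ### Elimination of the internal signals. -/

noncomputable section

namespace DescriptorNDS

variable (S : DescriptorNDS) {W : Type*} [AddCommGroup W] [Module ℝ W]

/-- The matrix expressing `v` through `x` when the external inputs vanish. -/
def gain : Matrix S.V S.X ℝ :=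
  (1 - S.Phi * Matrix.blockDiagonal' S.subAzv)⁻¹ * (S.Phi * Matrix.blockDiagonal' S.subAzx)

/-- The state matrix after elimination of the internal signals. -/
def redA : Matrix S.X S.X ℝ :=
  Matrix.blockDiagonal' S.subAxx + Matrix.blockDiagonal' S.subAxv * S.gain

/-- The output matrix after elimination of the internal signals. -/
def redC : Matrix S.Y S.X ℝ :=
  Matrix.blockDiagonal' S.subCx + Matrix.blockDiagonal' S.subCv * S.gain

variable {S}

theorem eq_gain_act_iff (hwp : S.WellPosed) (x : S.X → W) (v : S.V → W) :
    v = S.Phi.act ((Matrix.blockDiagonal' S.subAzx).act x +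
      (Matrix.blockDiagonal' S.subAzv).act v) ↔ v = S.gain.act x := by
  rw [Matrix.act_add, ← Matrix.mul_act, ← Matrix.mul_act, Matrix.eq_act_add_iff hwp, gain,
    ← Matrix.mul_act]

/-- The entries lie in an arbitrary `W`, so that one elimination serves real vectors (discrete time
and `0⁻`) and distributions alike. -/
theorem algebraicEquations_zero_iff (hwp : S.WellPosed) (x : S.X → W) (v : S.V → W)
    (z : S.Z → W) :
    AlgebraicEquations x 0 v z 0 ↔
      z = (Matrix.blockDiagonal' S.subAzx).act x + (Matrix.blockDiagonal' S.subAzv).act v ∧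
        v = S.gain.act x ∧ S.redC.act x = 0 := by
  have h0 : ∀ i, (fun k : Fin (S.mu i) => (0 : S.U → W) ⟨i, k⟩) = 0 := fun i => rfl
  have hz : (∀ i, (fun k => z ⟨i, k⟩) =
      (S.subAzx i).act (fun k => x ⟨i, k⟩) + (S.subAzv i).act (fun k => v ⟨i, k⟩) +
        (S.subBz i).act (fun k => (0 : S.U → W) ⟨i, k⟩)) ↔
      z = (Matrix.blockDiagonal' S.subAzx).act x + (Matrix.blockDiagonal' S.subAzv).act v := by
    simp only [h0, Matrix.act_zero, add_zero, funext_iff, Sigma.forall, Pi.add_apply,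
      Matrix.blockDiagonal'_act]
  have hy : (∀ i, (fun k => (0 : S.Y → W) ⟨i, k⟩) =
      (S.subCx i).act (fun k => x ⟨i, k⟩) + (S.subCv i).act (fun k => v ⟨i, k⟩) +
        (S.subD i).act (fun k => (0 : S.U → W) ⟨i, k⟩)) ↔
      0 = (Matrix.blockDiagonal' S.subCx).act x + (Matrix.blockDiagonal' S.subCv).act v := by
    simp only [h0, Matrix.act_zero, add_zero, funext_iff, Sigma.forall, Pi.add_apply,
      Matrix.blockDiagonal'_act]
  rw [AlgebraicEquations, hz, hy]
  refine and_congr_right fun hz => ?_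
  rw [hz, eq_gain_act_iff hwp, and_comm]
  refine and_congr_right fun hv => ?_
  rw [hv, redC, Matrix.add_act, Matrix.mul_act, eq_comm]

theorem stateEquations_zero_iff (dx x : S.X → W) :
    StateEquations dx x 0 (S.gain.act x) ↔ S.E.act dx = S.redA.act x := by
  have h0 : ∀ i, (fun k : Fin (S.mu i) => (0 : S.U → W) ⟨i, k⟩) = 0 := fun i => rfl
  rw [redA, Matrix.add_act, Matrix.mul_act, E]
  simp only [StateEquations, h0, Matrix.act_zero, add_zero, funext_iff, Sigma.forall, Pi.add_apply,
    Matrix.blockDiagonal'_act]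

theorem AlgebraicEquations.sub {x x' : S.X → W} {u u' : S.U → W} {v v' : S.V → W}
    {z z' : S.Z → W} {y y' : S.Y → W} (h : AlgebraicEquations x u v z y)
    (h' : AlgebraicEquations x' u' v' z' y') :
    AlgebraicEquations (x - x') (u - u') (v - v') (z - z') (y - y') := by
  obtain ⟨hz, hy, hv⟩ := h
  obtain ⟨hz', hy', hv'⟩ := h'
  have aux : ∀ {r s t q : Type} [Fintype r] [Fintype s] [Fintype t] (M : Matrix q r ℝ)
      (N : Matrix q s ℝ) (L : Matrix q t ℝ) (a a' : r → W) (b b' : s → W) (c c' : t → W)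
      (d d' : q → W), d = M.act a + N.act b + L.act c → d' = M.act a' + N.act b' + L.act c' →
      d - d' = M.act (a - a') + N.act (b - b') + L.act (c - c') := by
    rintro r s t q _ _ _ M N L a a' b b' c c' _ _ rfl rfl
    simp only [Matrix.act_sub]
    abel
  refine ⟨fun i => aux _ _ _ _ _ _ _ _ _ _ _ (hz i) (hz' i),
    fun i => aux _ _ _ _ _ _ _ _ _ _ _ (hy i) (hy' i), ?_⟩
  rw [Matrix.act_sub, ← hv, ← hv']

theorem StateEquations.sub {dx dx' x x' : S.X → W} {u u' : S.U → W} {v v' : S.V → W}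
    (h : StateEquations dx x u v) (h' : StateEquations dx' x' u' v') :
    StateEquations (dx - dx') (x - x') (u - u') (v - v') := by
  intro i
  have e : (fun k => (dx - dx') ⟨i, k⟩) = (fun k => dx ⟨i, k⟩) - fun k => dx' ⟨i, k⟩ := rfl
  have e1 : (fun k => (x - x') ⟨i, k⟩) = (fun k => x ⟨i, k⟩) - fun k => x' ⟨i, k⟩ := rfl
  have e2 : (fun k => (u - u') ⟨i, k⟩) = (fun k => u ⟨i, k⟩) - fun k => u' ⟨i, k⟩ := rfl
  have e3 : (fun k => (v - v') ⟨i, k⟩) = (fun k => v ⟨i, k⟩) - fun k => v' ⟨i, k⟩ := rfl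
  rw [e, e1, e2, e3]
  simp only [Matrix.act_sub]
  rw [h i, h' i]
  abel

/-! ### The augmented representation -/

variable (S) in
/-- The augmented internal input determined by `x` when the external inputs vanish. -/
def augInput (x : S.X → W) : S.Vbar → W
  | ⟨i, .inl k⟩ => S.gain.act x ⟨i, k⟩
  | ⟨i, .inr k⟩ => (S.lft i).act ((S.F1 i).act (fun k => x ⟨i, k⟩) +
      (S.F2 i).act (fun k => S.gain.act x ⟨i, k⟩)) k

theorem phiBar_act_inl (q : S.Zbar → W) (i : Fin S.N) (k : Fin (S.mv i)) :
    S.PhiBar.act q ⟨i, .inl k⟩ = S.Phi.act (fun b => q ⟨b.1, .inl b.2⟩) ⟨i, k⟩ := by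
  simp [Matrix.act, Fintype.sum_sigma, PhiBar]

theorem phiBar_act_inr (q : S.Zbar → W) (i : Fin S.N) (k : Fin (S.mp i)) :
    S.PhiBar.act q ⟨i, .inr k⟩ = (S.P i).act (fun l => q ⟨i, .inr l⟩) k := by
  rw [← Matrix.blockDiagonal'_act S.P (fun b => q ⟨b.1, .inr b.2⟩)]
  simp [Matrix.act, Fintype.sum_sigma, PhiBar]

theorem azx_azv_act_inl (x : S.X → W) (w : S.Vbar → W) (i : Fin S.N) (k : Fin (S.mz i)) :
    (S.Azx.act x + S.Azv.act w) ⟨i, .inl k⟩ =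
      ((S.Azx0 i).act (fun k => x ⟨i, k⟩) + ((S.Azv0 i).act (fun k => w ⟨i, .inl k⟩) +
        (S.H2 i).act (fun k => w ⟨i, .inr k⟩))) k := by
  simp only [Pi.add_apply, Azx, Azv, Matrix.blockDiagonal'_act]
  simp [Matrix.act]

theorem azx_azv_act_inr (x : S.X → W) (w : S.Vbar → W) (i : Fin S.N) (k : Fin (S.mq i)) :
    (S.Azx.act x + S.Azv.act w) ⟨i, .inr k⟩ =
      ((S.F1 i).act (fun k => x ⟨i, k⟩) + (S.F2 i).act (fun k => w ⟨i, .inl k⟩) +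
        (S.G i).act (fun k => w ⟨i, .inr k⟩)) k := by
  simp only [Pi.add_apply, Azx, Azv, Matrix.blockDiagonal'_act]
  simp [Matrix.act, add_assoc]

/-- Substituting the parameter signal `a = lft (F₁ x + F₂ v)` of a subsystem turns the augmented
matrices into those of the linear fractional transformation. -/
theorem lft_substitution {m n p q r : Type*} [Fintype m] [Fintype n] [Fintype p] [Fintype q]
    (M : Matrix r m ℝ) (N : Matrix r n ℝ) (H : Matrix r p ℝ) (L : Matrix p q ℝ) (F : Matrix q m ℝ)
    (F' : Matrix q n ℝ) (x : m → W) (v : n → W) :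
    M.act x + (N.act v + H.act (L.act (F.act x + F'.act v))) =
      (M + H * L * F).act x + (N + H * L * F').act v := by
  simp only [Matrix.act_add, Matrix.add_act, Matrix.mul_act]
  abel

/-- The augmented loop is solved in two stages. Its parameter components decouple into one feedback
loop per subsystem, solved through `1 - G P`. Substituting the solution turns the remaining
components into the interconnection loop `v = Φ z` of the original network, solved through
`WellPosed`. -/
theorem eq_augInput_iff (hsub : S.SubsystemsWellPosed) (hwp : S.WellPosed) (x : S.X → W)
    (w : S.Vbar → W) :
    w = S.PhiBar.act (S.Azx.act x + S.Azv.act w) ↔ w = S.augInput x := by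
  have hinr : (∀ i k, w ⟨i, .inr k⟩ = S.PhiBar.act (S.Azx.act x + S.Azv.act w) ⟨i, .inr k⟩) ↔
      ∀ i, (fun k => w ⟨i, .inr k⟩) = (S.lft i).act ((S.F1 i).act (fun k => x ⟨i, k⟩) +
        (S.F2 i).act (fun k => w ⟨i, .inl k⟩)) := by
    refine forall_congr' fun i => ?_
    rw [lft, ← Matrix.eq_act_feedback_iff (hsub i)]
    simp only [phiBar_act_inr, azx_azv_act_inr, funext_iff]
  have hinl (ha : ∀ i, (fun k => w ⟨i, .inr k⟩) =
      (S.lft i).act ((S.F1 i).act (fun k => x ⟨i, k⟩) +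
        (S.F2 i).act (fun k => w ⟨i, .inl k⟩))) :
      (∀ i k, w ⟨i, .inl k⟩ = S.PhiBar.act (S.Azx.act x + S.Azv.act w) ⟨i, .inl k⟩) ↔
        (fun a : S.V => w ⟨a.1, .inl a.2⟩) = S.gain.act x := by
    rw [← eq_gain_act_iff hwp]
    have : (fun b : S.Z => (S.Azx.act x + S.Azv.act w) ⟨b.1, .inl b.2⟩) =
        (Matrix.blockDiagonal' S.subAzx).act x +
          (Matrix.blockDiagonal' S.subAzv).act (fun a : S.V => w ⟨a.1, .inl a.2⟩) := by
      ext ⟨i, k⟩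
      rw [azx_azv_act_inl, ha i, lft_substitution]
      simp only [Pi.add_apply, Matrix.blockDiagonal'_act]
      rfl
    simp only [phiBar_act_inl, this, funext_iff, Sigma.forall]
  constructor
  · intro h
    have ha := hinr.1 fun i k => congrFun h _
    have hv := (hinl ha).1 fun i k => congrFun h _
    ext ⟨i, k | k⟩
    · exact congrFun hv ⟨i, k⟩
    · have := congrFun (ha i) k
      rw [this, augInput]
      have hvi : (fun k => w ⟨i, .inl k⟩) = fun k => S.gain.act x ⟨i, k⟩ :=
        funext fun k => congrFun hv ⟨i, k⟩
      rw [hvi]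
  · intro h
    have hv : (fun a : S.V => w ⟨a.1, .inl a.2⟩) = S.gain.act x := by rw [h]; rfl
    have ha : ∀ i, (fun k => w ⟨i, .inr k⟩) =
      (S.lft i).act ((S.F1 i).act (fun k => x ⟨i, k⟩) +
        (S.F2 i).act (fun k => w ⟨i, .inl k⟩)) := by
      intro i; rw [h]; rfl
    ext ⟨i, k | k⟩
    · exact (hinl ha).2 hv i k
    · exact hinr.2 ha i k

theorem axx_act_add_axv_act (x : S.X → W) :
    S.Axx.act x + S.Axv.act (S.augInput x) = S.redA.act x := by
  rw [redA, Matrix.add_act, Matrix.mul_act]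
  ext ⟨i, k⟩
  simp only [Pi.add_apply, Axx, Axv, Matrix.blockDiagonal'_act, Matrix.fromCols_act]
  exact congrFun (lft_substitution (S.Axx0 i) (S.Axv0 i) (S.H1 i) (S.lft i) (S.F1 i) (S.F2 i)
    (fun k => x ⟨i, k⟩) (fun k => S.gain.act x ⟨i, k⟩)) k

theorem cx_act_add_cv_act (x : S.X → W) :
    S.Cx.act x + S.Cv.act (S.augInput x) = S.redC.act x := by
  rw [redC, Matrix.add_act, Matrix.mul_act]
  ext ⟨i, k⟩
  simp only [Pi.add_apply, Cx, Cv, Matrix.blockDiagonal'_act, Matrix.fromCols_act]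
  exact congrFun (lft_substitution (S.Cx0 i) (S.Cv0 i) (S.H3 i) (S.lft i) (S.F1 i) (S.F2 i)
    (fun k => x ⟨i, k⟩) (fun k => S.gain.act x ⟨i, k⟩)) k

theorem augInput_zero : S.augInput (0 : S.X → W) = 0 := by
  ext ⟨i, k | k⟩
  · simp [augInput]
  · simp only [augInput, Matrix.act_zero]
    change (S.lft i).act ((S.F1 i).act 0 + (S.F2 i).act 0) k = 0
    simp

theorem phiBar_loop_iff (x : S.X → W) (w : S.Vbar → W) :
    -(S.PhiBar * S.Azx).act x + (1 - S.PhiBar * S.Azv).act w = 0 ↔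
      w = S.PhiBar.act (S.Azx.act x + S.Azv.act w) := by
  rw [Matrix.sub_act, Matrix.one_act, Matrix.act_add, Matrix.mul_act, Matrix.mul_act,
    ← sub_eq_zero (a := w)]
  refine Eq.congr ?_ rfl
  abel

theorem neg_output_eq_zero_iff (x : S.X → W) :
    -S.Cx.act x + -S.Cv.act (S.augInput x) = 0 ↔ S.redC.act x = 0 := by
  rw [← cx_act_add_cv_act, ← neg_add, neg_eq_zero]

/-- The last block row of the matrix forces the second component of a kernel vector to be `augInput
x`, so the kernel is parametrized by `x` alone. The same holds for the pencil in
`mPencil_isFCR_iff`. -/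
theorem mInf_isFCR_iff (hsub : S.SubsystemsWellPosed) (hwp : S.WellPosed) :
    S.MInf.IsFCR ↔ ∀ x : S.X → ℝ, S.E.act x = 0 → S.redC.act x = 0 → x = 0 := by
  rw [Matrix.isFCR_iff]
  have key : ∀ (x : S.X → ℝ) (w : S.Vbar → ℝ), S.MInf *ᵥ Sum.elim x w = 0 ↔
      S.E.act x = 0 ∧ S.redC.act x = 0 ∧ w = S.augInput x := by
    intro x w
    have : S.MInf *ᵥ Sum.elim x w = Sum.elim (S.E.act x)
        (Sum.elim (-S.Cx.act x + -S.Cv.act w)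
          (-(S.PhiBar * S.Azx).act x + (1 - S.PhiBar * S.Azv).act w)) := by
      simp only [MInf, Matrix.fromRows_mulVec, Matrix.fromCols_mulVec, Matrix.act_eq_mulVec,
        Matrix.neg_mulVec, Matrix.zero_mulVec, add_zero, Sum.elim_comp_inl, Sum.elim_comp_inr]
    rw [this, ← Sum.elim_zero_zero, ← Sum.elim_zero_zero, Sum.elim_eq_iff, Sum.elim_eq_iff,
      phiBar_loop_iff, eq_augInput_iff hsub hwp]
    refine and_congr_right fun _ => and_congr_left fun hw => ?_
    rw [hw, neg_output_eq_zero_iff]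
  constructor
  · intro h x hE hC
    have := h _ ((key x _).2 ⟨hE, hC, rfl⟩)
    exact funext fun k => congrFun this (.inl k)
  · intro h xw hxw
    rw [← Sum.elim_comp_inl_inr xw] at hxw ⊢
    obtain ⟨hE, hC, hw⟩ := (key _ _).1 hxw
    rw [h _ hE hC, augInput_zero] at hw
    rw [hw, h _ hE hC, Sum.elim_zero_zero]

theorem mPencil_isFCR_iff (hsub : S.SubsystemsWellPosed) (hwp : S.WellPosed) (lam : ℂ) :
    (S.MPencil lam).IsFCR ↔
      ∀ x : S.X → ℂ, S.redA.act x = lam • S.E.act x → S.redC.act x = 0 → x = 0 := by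
  rw [Matrix.isFCR_iff]
  have key : ∀ (x : S.X → ℂ) (w : S.Vbar → ℂ), S.MPencil lam *ᵥ Sum.elim x w = 0 ↔
      S.redA.act x = lam • S.E.act x ∧ S.redC.act x = 0 ∧ w = S.augInput x := by
    intro x w
    have : S.MPencil lam *ᵥ Sum.elim x w = Sum.elim
        (lam • S.E.act x - S.Axx.act x + -S.Axv.act w)
        (Sum.elim (-S.Cx.act x + -S.Cv.act w)
          (-(S.PhiBar * S.Azx).act x + (1 - S.PhiBar * S.Azv).act w)) := by
      simp only [MPencil, Matrix.fromRows_mulVec, Matrix.fromCols_mulVec,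
        Matrix.act_eq_map_mulVec, Matrix.sub_mulVec, Matrix.smul_mulVec,
        Matrix.neg_mulVec, Sum.elim_comp_inl, Sum.elim_comp_inr]
    rw [this, ← Sum.elim_zero_zero, ← Sum.elim_zero_zero, Sum.elim_eq_iff, Sum.elim_eq_iff,
      phiBar_loop_iff, eq_augInput_iff hsub hwp, ← and_assoc, ← and_assoc]
    refine and_congr_left fun hw => ?_
    rw [hw, neg_output_eq_zero_iff, ← sub_eq_add_neg, sub_sub, axx_act_add_axv_act, sub_eq_zero,
      eq_comm]
  constructor
  · intro h x hE hC
    have := h _ ((key x _).2 ⟨hE, hC, rfl⟩)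
    exact funext fun k => congrFun this (.inl k)
  · intro h xw hxw
    rw [← Sum.elim_comp_inl_inr xw] at hxw ⊢
    obtain ⟨hE, hC, hw⟩ := (key _ _).1 hxw
    rw [h _ hE hC, augInput_zero] at hw
    rw [hw, h _ hE hC, Sum.elim_zero_zero]

end DescriptorNDS

end

/-! ### Invariant subspaces of the pencil, and the difference equation. -/

noncomputable section

namespace Matrix

variable {m n p : Type*} [Fintype n]

/-- The complexification of a real subspace of `n → ℝ`. -/
def complexify (K : Submodule ℝ (n → ℝ)) : Submodule ℂ (n → ℂ) where
  carrier := {w | (fun k => (w k).re) ∈ K ∧ (fun k => (w k).im) ∈ K}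
  zero_mem' := ⟨K.zero_mem, K.zero_mem⟩
  add_mem' h h' := ⟨K.add_mem h.1 h'.1, K.add_mem h.2 h'.2⟩
  smul_mem' c w h := by
    refine ⟨?_, ?_⟩
    · convert! K.sub_mem (K.smul_mem c.re h.1) (K.smul_mem c.im h.2) using 1
    · convert! K.add_mem (K.smul_mem c.re h.2) (K.smul_mem c.im h.1) using 1

theorem re_act (M : Matrix m n ℝ) (w : n → ℂ) :
    (fun i => (M.act w i).re) = M.act fun k => (w k).re :=
  (M.map_act Complex.reLm w).symm

theorem im_act (M : Matrix m n ℝ) (w : n → ℂ) :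
    (fun i => (M.act w i).im) = M.act fun k => (w k).im :=
  (M.map_act Complex.imLm w).symm

theorem act_eq_iff_re_im (M : Matrix m n ℝ) (w : n → ℂ) (b : m → ℂ) :
    M.act w = b ↔ M.act (fun k => (w k).re) = (fun i => (b i).re) ∧
      M.act (fun k => (w k).im) = fun i => (b i).im := by
  rw [← re_act, ← im_act]
  constructor
  · rintro rfl; exact ⟨rfl, rfl⟩
  · rintro ⟨h1, h2⟩
    ext i
    exact Complex.ext (congrFun h1 i) (congrFun h2 i)

/-- If the pencil `(λ E - A; C)` has trivial kernel for every finite `λ` and `(E; C)` has trivial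
kernel, then `0` is the only subspace `K` of `ker C` with `A K ⊆ E K`. -/
theorem eq_bot_of_pencil_invariant {E A : Matrix m n ℝ} {C : Matrix p n ℝ}
    (hinf : ∀ w : n → ℝ, E.act w = 0 → C.act w = 0 → w = 0)
    (hfin : ∀ (lam : ℂ) (w : n → ℂ), A.act w = lam • E.act w → C.act w = 0 → w = 0)
    {K : Submodule ℝ (n → ℝ)} (hC : ∀ w ∈ K, C.act w = 0)
    (hA : ∀ w ∈ K, ∃ w' ∈ K, A.act w = E.act w') : K = ⊥ := by
  have hCc : ∀ w ∈ complexify K, C.act w = 0 := fun w hw =>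
    (act_eq_iff_re_im C w 0).2 ⟨hC _ hw.1, hC _ hw.2⟩
  -- The condition at infinity, applied to real and imaginary parts, makes `E` injective on the
  -- complexification. The solution `w'` of `A w = E w'` is therefore unique, which is what makes
  -- `f` below linear.
  have hinj : ∀ w ∈ complexify K, ∀ w' ∈ complexify K, E.act w = E.act w' → w = w' := by
    intro w hw w' hw' h
    have hd := (complexify K).sub_mem hw hw'
    have h0 : E.act (w - w') = 0 := by rw [act_sub, h, sub_self]
    rw [act_eq_iff_re_im] at h0
    have h1 := hinf _ h0.1 (hC _ hd.1)
    have h2 := hinf _ h0.2 (hC _ hd.2)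
    refine sub_eq_zero.1 (funext fun k => Complex.ext (congrFun h1 k) (congrFun h2 k))
  have hAc : ∀ w : complexify K, ∃ w' : complexify K, A.act w.1 = E.act w'.1 := by
    rintro ⟨w, hw⟩
    obtain ⟨a, ha, ha'⟩ := hA _ hw.1
    obtain ⟨b, hb, hb'⟩ := hA _ hw.2
    refine ⟨⟨fun k => ⟨a k, b k⟩, ha, hb⟩, ?_⟩
    rw [act_eq_iff_re_im, re_act, im_act]
    exact ⟨ha', hb'⟩
  choose f hf using hAc
  let M : Module.End ℂ (complexify K) :=
    { toFun := f
      map_add' := fun w w' => Subtype.ext <| hinj _ (f _).2 _ (f w + f w').2 <| by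
        rw [← hf, Submodule.coe_add, Submodule.coe_add, act_add, act_add, hf, hf]
      map_smul' := fun c w => Subtype.ext <| hinj _ (f _).2 _ (c • f w).2 <| by
        rw [← hf, Submodule.coe_smul, Submodule.coe_smul, act_smul_complex, act_smul_complex, hf]
        rfl }
  -- On a nonzero space `M` has an eigenvector over `ℂ`; `M w = λ w` reads `A w = λ E w`, contrary
  -- to `hfin`.
  have hsub : Subsingleton (complexify K) := by
    by_contra hns
    rw [not_subsingleton_iff_nontrivial] at hns
    obtain ⟨lam, hlam⟩ := Module.End.exists_eigenvalue M
    obtain ⟨w, hw⟩ := hlam.exists_hasEigenvector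
    refine hw.2 (Subtype.ext (hfin lam w.1 ?_ (hCc _ w.2)))
    have h1 : f w = lam • w := hw.apply_eq_smul
    rw [hf, h1, Submodule.coe_smul, act_smul_complex]
  rw [Submodule.eq_bot_iff]
  intro w hw
  have hmem : (fun k => (w k : ℂ)) ∈ complexify K :=
    ⟨hw, K.zero_mem⟩
  have := congrArg Subtype.val (hsub.elim ⟨_, hmem⟩ 0)
  funext k
  exact Complex.ofReal_eq_zero.1 (congrFun this k)

/-! ### Discrete-time observability of the descriptor system `E x⁺ = A x`, `C x = 0` -/

/-- The initial values of the solutions of `E x(t+1) = A x(t)`, `C x(t) = 0` on `{0, …, T}`. -/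
def initialValues (E A : Matrix m n ℝ) (C : Matrix p n ℝ) (T : ℕ) : Submodule ℝ (n → ℝ) where
  carrier := {w | ∃ x : ℕ → n → ℝ, x 0 = w ∧ (∀ t ≤ T, C.act (x t) = 0) ∧
    ∀ t < T, E.act (x (t + 1)) = A.act (x t)}
  zero_mem' := ⟨0, rfl, by simp, by simp⟩
  add_mem' := by
    rintro _ _ ⟨x, rfl, hC, hE⟩ ⟨x', rfl, hC', hE'⟩
    refine ⟨x + x', rfl, fun t ht => ?_, fun t ht => ?_⟩
    · rw [Pi.add_apply, act_add, hC t ht, hC' t ht, add_zero]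
    · rw [Pi.add_apply, Pi.add_apply, act_add, act_add, hE t ht, hE' t ht]
  smul_mem' := by
    rintro c _ ⟨x, rfl, hC, hE⟩
    refine ⟨c • x, rfl, fun t ht => ?_, fun t ht => ?_⟩
    · have := hC t ht
      rw [act_eq_mulVec] at this ⊢
      rw [Pi.smul_apply, mulVec_smul, this, smul_zero]
    · have := hE t ht
      rw [act_eq_mulVec, act_eq_mulVec] at this ⊢
      rw [Pi.smul_apply, Pi.smul_apply, mulVec_smul, mulVec_smul, this]

/-- A longer horizon imposes more constraints, so the spaces of initial values decrease and
stabilize by finite dimension. Deleting the first sample of a solution on `{0, …, T₀ + 1}` leaves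
one on `{0, …, T₀}` starting at `x 1`, and `A (x 0) = E (x 1)`; the stable space thus satisfies `A K
⊆ E K`. -/
theorem exists_initialValues_eq_bot {E A : Matrix m n ℝ} {C : Matrix p n ℝ}
    (hinf : ∀ w : n → ℝ, E.act w = 0 → C.act w = 0 → w = 0)
    (hfin : ∀ (lam : ℂ) (w : n → ℂ), A.act w = lam • E.act w → C.act w = 0 → w = 0) :
    ∃ T₀, ∀ T ≥ T₀, initialValues E A C T = ⊥ := by
  have hanti : Antitone (initialValues E A C) := by
    rintro s t hst _ ⟨x, rfl, hC, hE⟩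
    exact ⟨x, rfl, fun r hr => hC r (hr.trans hst), fun r hr => hE r (hr.trans_le hst)⟩
  obtain ⟨T₀, hT₀⟩ := IsArtinian.monotone_stabilizes
    (⟨fun T => OrderDual.toDual (initialValues E A C T), fun s t h => hanti h⟩ :
      ℕ →o (Submodule ℝ (n → ℝ))ᵒᵈ)
  have hstab : initialValues E A C T₀ = initialValues E A C (T₀ + 1) := hT₀ _ T₀.le_succ
  have hbot : initialValues E A C T₀ = ⊥ := by
    refine eq_bot_of_pencil_invariant hinf hfin ?_ ?_
    · rintro _ ⟨x, rfl, hC, -⟩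
      exact hC 0 T₀.zero_le
    · intro w hw
      rw [hstab] at hw
      obtain ⟨x, rfl, hC, hE⟩ := hw
      exact ⟨x 1, ⟨fun t => x (t + 1), rfl, fun t ht => hC _ (by omega),
        fun t ht => hE _ (by omega)⟩, (hE 0 (by omega)).symm⟩
  exact ⟨T₀, fun T hT => le_bot_iff.1 (hbot ▸ hanti hT)⟩

/-- Once `x 0 = 0`, the condition at infinity propagates zero forward: `x t = 0` gives `E (x (t +
1)) = 0`, while `C (x (t + 1)) = 0`. -/
theorem exists_discrete_solutions_eq_zero {E A : Matrix m n ℝ} {C : Matrix p n ℝ}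
    (hinf : ∀ w : n → ℝ, E.act w = 0 → C.act w = 0 → w = 0)
    (hfin : ∀ (lam : ℂ) (w : n → ℂ), A.act w = lam • E.act w → C.act w = 0 → w = 0) :
    ∃ T₀, ∀ T ≥ T₀, ∀ x : ℕ → n → ℝ, (∀ t ≤ T, C.act (x t) = 0) →
      (∀ t < T, E.act (x (t + 1)) = A.act (x t)) → ∀ t ≤ T, x t = 0 := by
  obtain ⟨T₀, hT₀⟩ := exists_initialValues_eq_bot hinf hfin
  refine ⟨T₀, fun T hT x hC hE t => ?_⟩
  induction t with
  | zero =>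
    intro _
    have : x 0 ∈ initialValues E A C T := ⟨x, rfl, hC, hE⟩
    rwa [hT₀ T hT] at this
  | succ t ih =>
    intro ht
    refine hinf _ ?_ (hC _ ht)
    rw [hE t ht, ih (Nat.le_of_succ_le ht), act_zero]

/-- A mode `λᵗ w` of the pencil, composed with a real-linear functional on `ℂ`, satisfies the
difference equation. -/
theorem act_mode {E A : Matrix m n ℝ} {lam : ℂ} {w : n → ℂ} (h : A.act w = lam • E.act w)
    {V : Type*} [AddCommGroup V] [Module ℝ V] (L : ℂ →ₗ[ℝ] V) (c : ℂ) :
    E.act (fun k => L (c * lam * w k)) = A.act fun k => L (c * w k) := by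
  rw [map_act L E (fun k => c * lam * w k), map_act L A (fun k => c * w k)]
  have h1 : E.act (fun k => c * lam * w k) = (c * lam) • E.act w := act_smul_complex _ _ _
  have h2 : A.act (fun k => c * w k) = c • A.act w := act_smul_complex _ _ _
  rw [h1, h2, h, smul_smul]

theorem act_mode_eq_zero {C : Matrix p n ℝ} {w : n → ℂ} (h : C.act w = 0)
    {V : Type*} [AddCommGroup V] [Module ℝ V] (L : ℂ →ₗ[ℝ] V) (c : ℂ) :
    C.act (fun k => L (c * w k)) = 0 := by
  rw [map_act L C (fun k => c * w k)]
  have h2 : C.act (fun k => c * w k) = c • C.act w := act_smul_complex _ _ _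
  rw [h2, h, smul_zero]
  exact funext fun i => map_zero L

end Matrix

/-! ### Observability of the network in discrete time. -/

namespace DescriptorNDS

variable {S : DescriptorNDS}

theorem IsDiscreteTrajectory.sub {T : ℕ} {x x' : ℕ → S.X → ℝ} {u u' : ℕ → S.U → ℝ}
    {v v' : ℕ → S.V → ℝ} {z z' : ℕ → S.Z → ℝ} {y y' : ℕ → S.Y → ℝ}
    (h : S.IsDiscreteTrajectory T x u v z y) (h' : S.IsDiscreteTrajectory T x' u' v' z' y') :
    S.IsDiscreteTrajectory T (x - x') (u - u') (v - v') (z - z') (y - y') :=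
  ⟨fun t ht => (h.algebraic t ht).sub (h'.algebraic t ht),
    fun t ht => (h.state t ht).sub (h'.state t ht)⟩

theorem exists_isDiscreteTrajectory (hwp : S.WellPosed) {T : ℕ} {x : ℕ → S.X → ℝ}
    (hC : ∀ t ≤ T, S.redC.act (x t) = 0) (hE : ∀ t < T, S.E.act (x (t + 1)) = S.redA.act (x t)) :
    ∃ v z, S.IsDiscreteTrajectory T x 0 v z 0 :=
  ⟨fun t => S.gain.act (x t), _,
    fun t ht => (algebraicEquations_zero_iff hwp (x t) _ _).2 ⟨rfl, rfl, hC t ht⟩,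
    fun t ht => (stateEquations_zero_iff _ _).2 (hE t ht)⟩

theorem completelyObservable_discrete_iff (hwp : S.WellPosed) :
    S.CompletelyObservable .discrete ↔
      (∀ w : S.X → ℝ, S.E.act w = 0 → S.redC.act w = 0 → w = 0) ∧
      ∀ (lam : ℂ) (w : S.X → ℂ), S.redA.act w = lam • S.E.act w → S.redC.act w = 0 → w = 0 := by
  constructor
  · rintro ⟨T₀, h⟩
    have hzero : ∀ T ≥ T₀, ∀ x : ℕ → S.X → ℝ, (∀ t ≤ T, S.redC.act (x t) = 0) →
        (∀ t < T, S.E.act (x (t + 1)) = S.redA.act (x t)) → ∀ t ≤ T, x t = 0 := by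
      intro T hT x hC hE
      obtain ⟨v, z, hx⟩ := exists_isDiscreteTrajectory hwp hC hE
      obtain ⟨v', z', h0⟩ := exists_isDiscreteTrajectory (S := S) (T := T) (x := 0) hwp
        (by simp) (by simp)
      exact h T hT x 0 0 0 v v' z z' 0 0 hx h0 fun _ _ => ⟨rfl, rfl⟩
    refine ⟨fun w hE hC => ?_, fun lam w hA hC => ?_⟩
    -- A pulse `w` at the final time: no state equation starts there, so `w` enters the dynamics
    -- only through `E w = 0`.
    · have := hzero (T₀ + 1) (by omega) (fun t => if t = T₀ + 1 then w else 0) ?_ ?_ (T₀ + 1) le_rfl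
      · simpa using this
      · intro t _
        split_ifs
        · exact hC
        · simp
      · intro t ht
        have : t ≠ T₀ + 1 := ht.ne
        simp only [this, if_false, Matrix.act_zero]
        split_ifs
        · exact hE
        · simp
    -- Real and imaginary parts of the complex mode `λ ^ t w` are real trajectories; at `t = 0` they
    -- give the parts of `w`, also when `λ = 0`.
    · have hL : ∀ (L : ℂ →ₗ[ℝ] ℝ) k, L (w k) = 0 := by
        intro L k
        have := hzero T₀ le_rfl (fun t k => L (lam ^ t * w k))
          (fun t _ => Matrix.act_mode_eq_zero hC L _)
          (fun t _ => by simpa only [pow_succ] using Matrix.act_mode hA L (lam ^ t)) 0 T₀.zero_le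
        simpa using congrFun this k
      exact funext fun k => Complex.ext (hL Complex.reLm k) (hL Complex.imLm k)
  · rintro ⟨hinf, hfin⟩
    obtain ⟨T₀, h⟩ := Matrix.exists_discrete_solutions_eq_zero hinf hfin
    refine ⟨T₀, fun T hT x x' u u' v v' z z' y y' hx hx' huy t ht => ?_⟩
    have hd := hx.sub hx'
    have halg : ∀ t ≤ T, AlgebraicEquations ((x - x') t) 0 ((v - v') t) ((z - z') t) 0 := by
      intro t ht
      have := hd.algebraic t ht
      rwa [show (u - u') t = 0 from sub_eq_zero.2 (huy t ht).1,
        show (y - y') t = 0 from sub_eq_zero.2 (huy t ht).2] at this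
    refine sub_eq_zero.1 (h T hT (x - x') (fun t ht => ?_) (fun t ht => ?_) t ht)
    · exact ((algebraicEquations_zero_iff hwp _ _ _).1 (halg t ht)).2.2
    · have := hd.state t ht
      rwa [show (u - u') t = 0 from sub_eq_zero.2 (huy t ht.le).1,
        ((algebraicEquations_zero_iff hwp _ _ _).1 (halg t ht.le)).2.1,
        stateEquations_zero_iff] at this

end DescriptorNDS

end

/-! ### Impulses and causal exponentials as distributions. -/

noncomputable section

open Polynomial MeasureTheory Filter Topology

namespace DescriptorNDS.Dist

/-- The distributional derivative as a linear map. -/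
def diff : Dist →ₗ[ℝ] Dist := (Distribution.lineDerivCLM (1 : ℝ)).toLinearMap

theorem diff_apply_apply (T : Dist) (f : 𝓓((⊤ : TopologicalSpace.Opens ℝ), ℝ)) :
    diff T f = -T (∂_{(1 : ℝ)} f) := rfl

theorem testFunction_lineDeriv_apply (f : 𝓓((⊤ : TopologicalSpace.Opens ℝ), ℝ)) (t : ℝ) :
    (∂_{(1 : ℝ)} f) t = deriv f t := by
  rw [TestFunction.lineDerivOp_eq_lineDerivCLM (𝕜 := ℝ),
    TestFunction.lineDerivCLM_apply_of_le (by simp)]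
  simp [((f.contDiff.differentiable (by simp)) t).lineDeriv_eq_fderiv]

/-- The distribution `p(∂) δ₀` of a polynomial `p`. -/
def impulse : ℝ[X] →ₗ[ℝ] Dist where
  toFun p := aeval diff p (Distribution.delta (0 : ℝ))
  map_add' p q := by simp
  map_smul' c p := by simp

theorem impulse_X_mul (p : ℝ[X]) : impulse (Polynomial.X * p) = diff (impulse p) := by
  simp [impulse]

theorem impulse_C (c : ℝ) : impulse (C c) = c • (Distribution.delta (0 : ℝ) : Dist) := by
  simp [impulse, Algebra.algebraMap_eq_smul_one]

/-- On a test function that equals `c e^{-λ t}` near `0`, the distribution `p(∂) δ₀` takes the value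
`c p(λ)`. -/
theorem impulse_apply_of_eventuallyEq (p : ℝ[X]) (lam c : ℝ)
    (f : 𝓓((⊤ : TopologicalSpace.Opens ℝ), ℝ))
    (hf : f =ᶠ[𝓝 0] fun t => c * Real.exp (-lam * t)) : impulse p f = c * p.eval lam := by
  induction p using Polynomial.induction_on generalizing c f with
  | C a =>
    rw [impulse_C]
    change a * f 0 = _
    rw [hf.eq_of_nhds]
    simp [mul_comm]
  | add p q hp hq =>
    rw [map_add, eval_add, mul_add, ← hp c f hf, ← hq c f hf]
    rfl
  | monomial n a ih =>
    have : C a * Polynomial.X ^ (n + 1) = Polynomial.X * (C a * Polynomial.X ^ n) := by ring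
    -- Differentiating the test function replaces `c` by `-λ c`, and the sign in the distributional
    -- derivative restores `λ c`. This is why the exponent is `-λ t`.
    rw [this, impulse_X_mul, diff_apply_apply, ih (-lam * c), eval_mul (p := Polynomial.X), eval_X]
    · ring
    · have h := hf.deriv
      filter_upwards [h] with t ht
      rw [testFunction_lineDeriv_apply, ht]
      have : HasDerivAt (fun t => c * Real.exp (-lam * t)) (c * (Real.exp (-lam * t) * (-lam * 1))) t :=
        (((hasDerivAt_id t).const_mul (-lam)).exp).const_mul c
      rw [this.deriv]
      ring

theorem exists_testFunction_eventuallyEq_exp (lam : ℝ) :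
    ∃ f : 𝓓((⊤ : TopologicalSpace.Opens ℝ), ℝ), f =ᶠ[𝓝 0] fun t => Real.exp (-lam * t) := by
  let b : ContDiffBump (0 : ℝ) := ⟨1, 2, one_pos, one_lt_two⟩
  refine ⟨⟨fun t => b t * Real.exp (-lam * t), ?_, ?_, by simp⟩, ?_⟩
  · exact b.contDiff.mul (by fun_prop)
  · exact b.hasCompactSupport.mul_right
  · filter_upwards [b.eventuallyEq_one] with t ht
    change b t * _ = _
    rw [ht]
    simp

/-- Pairing `p(∂) δ₀` with a test function equal to `e^{-λ t}` near `0` reads off `p(λ)`, and a real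
polynomial is determined by its values at real `λ`. -/
theorem impulse_injective : Function.Injective impulse := by
  rw [← LinearMap.ker_eq_bot, LinearMap.ker_eq_bot']
  intro p hp
  refine Polynomial.funext fun lam => ?_
  obtain ⟨f, hf⟩ := exists_testFunction_eventuallyEq_exp lam
  have h := impulse_apply_of_eventuallyEq p lam 1 f (by simpa using hf)
  rw [hp] at h
  simpa using h.symm

/-! ### Causal exponential modes -/

theorem locallyIntegrableOn_mode (lam c : ℂ) :
    LocallyIntegrableOn (fun t : ℝ => (c * Complex.exp (lam * t)).re)
      ((⊤ : TopologicalSpace.Opens ℝ) : Set ℝ) (volume.restrict (Set.Ioi 0)) := by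
  have : Continuous fun t : ℝ => (c * Complex.exp (lam * t)).re := by fun_prop
  exact this.locallyIntegrable.locallyIntegrableOn _

/-- The distribution `Re (c e^{λ t})` on `t > 0`, extended by `0`. -/
def modeAt (lam c : ℂ) : Dist :=
  let T : 𝓓((⊤ : TopologicalSpace.Opens ℝ), ℝ) →L[ℝ] ℝ :=
    TestFunction.integralAgainstBilinCLM (ContinuousLinearMap.mul ℝ ℝ)
      (volume.restrict (Set.Ioi 0)) fun t : ℝ => (c * Complex.exp (lam * t)).re
  { T with }

theorem modeAt_apply (lam c : ℂ) (f : 𝓓((⊤ : TopologicalSpace.Opens ℝ), ℝ)) :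
    modeAt lam c f = ∫ t in Set.Ioi (0 : ℝ), f t * (c * Complex.exp (lam * t)).re :=
  TestFunction.integralAgainstBilinCLM_eq_integral (locallyIntegrableOn_mode lam c)

theorem integrableOn_mul_mode (lam c : ℂ) (f : 𝓓((⊤ : TopologicalSpace.Opens ℝ), ℝ)) :
    IntegrableOn (fun t : ℝ => f t * (c * Complex.exp (lam * t)).re) (Set.Ioi 0) := by
  refine Integrable.integrableOn (Continuous.integrable_of_hasCompactSupport ?_ ?_)
  · exact f.continuous.mul (by fun_prop)
  · exact f.hasCompactSupport.mul_right

/-- The distribution `Re (c e^{λ t})` on `t > 0`, as a linear map of `c`. -/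
def mode (lam : ℂ) : ℂ →ₗ[ℝ] Dist where
  toFun c := modeAt lam c
  map_add' c d := by
    ext f
    change _ = modeAt lam c f + modeAt lam d f
    simp only [modeAt_apply]
    rw [← integral_add (integrableOn_mul_mode lam c f) (integrableOn_mul_mode lam d f)]
    refine integral_congr_ae (.of_forall fun t => ?_)
    simp only [add_mul, Complex.add_re, mul_add]
  map_smul' r c := by
    ext f
    change _ = r * modeAt lam c f
    simp only [modeAt_apply]
    rw [← integral_const_mul]
    refine integral_congr_ae (.of_forall fun t => ?_)
    simp only [smul_mul_assoc, Complex.smul_re, smul_eq_mul]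
    ring

theorem mode_apply (lam c : ℂ) (f : 𝓓((⊤ : TopologicalSpace.Opens ℝ), ℝ)) :
    mode lam c f = ∫ t in Set.Ioi (0 : ℝ), f t * (c * Complex.exp (lam * t)).re :=
  modeAt_apply lam c f

theorem causal_mode (lam c : ℂ) : Causal (mode lam c) := by
  intro f hf
  rw [mode_apply]
  refine setIntegral_eq_zero_of_forall_eq_zero fun t ht => ?_
  have : f t = 0 := image_eq_zero_of_notMem_tsupport fun h => lt_asymm (Set.mem_Ioi.1 ht) (hf h)
  rw [this, zero_mul]

/-- Integration by parts on `(0, ∞)`: the boundary term at `0` is the jump `Re c`. It is exactly the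
impulse that the term `- x₀ δ₀` of the state equation removes when `x₀ = Re c`. -/
theorem diff_mode (lam c : ℂ) :
    diff (mode lam c) = mode lam (lam * c) + c.re • (Distribution.delta (0 : ℝ) : Dist) := by
  ext f
  change -mode lam c (∂_{(1 : ℝ)} f) = mode lam (lam * c) f + c.re * f 0
  have hg : ∀ t : ℝ, HasDerivAt (fun t : ℝ => (c * Complex.exp (lam * t)).re)
      (lam * c * Complex.exp (lam * t)).re t := by
    intro t
    have h : HasDerivAt (fun s : ℂ => c * Complex.exp (lam * s))
        (c * (Complex.exp (lam * t) * (lam * 1))) (t : ℂ) :=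
      (((hasDerivAt_id (t : ℂ)).const_mul lam).cexp).const_mul c
    convert! h.real_of_complex using 2
    ring
  have hf : ∀ t, HasDerivAt f (deriv f t) t := fun t =>
    ((f.contDiff.differentiable (by simp)) t).hasDerivAt
  have hd : ∀ t : ℝ, deriv (fun t : ℝ => f t * (c * Complex.exp (lam * t)).re) t =
      (∂_{(1 : ℝ)} f) t * (c * Complex.exp (lam * t)).re +
        f t * (lam * c * Complex.exp (lam * t)).re := fun t => by
    rw [testFunction_lineDeriv_apply]
    exact ((hf t).mul (hg t)).deriv
  have hsm : ContDiff ℝ 1 (fun t : ℝ => f t * (c * Complex.exp (lam * t)).re) := by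
    refine (f.contDiff.of_le (by simp)).mul ?_
    refine Complex.reCLM.contDiff.comp (contDiff_const.mul ?_)
    exact (contDiff_const.mul Complex.ofRealCLM.contDiff).cexp
  have h := HasCompactSupport.integral_Ioi_deriv_eq hsm f.hasCompactSupport.mul_right 0
  simp only [hd] at h
  rw [integral_add (integrableOn_mul_mode lam c _) (integrableOn_mul_mode lam (lam * c) f),
    ← mode_apply, ← mode_apply] at h
  simp only [Complex.ofReal_zero, mul_zero, Complex.exp_zero, mul_one] at h
  linarith

/-! ### Causal distributions form a subspace -/

/-- The space of causal distributions. -/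
def causalSubmodule : Submodule ℝ Dist where
  carrier := {T | Causal T}
  zero_mem' _ _ := rfl
  add_mem' {T T'} h h' f hf := by
    change T f + T' f = 0
    rw [h f hf, h' f hf, add_zero]
  smul_mem' c T h f hf := by
    change c * T f = 0
    rw [h f hf, mul_zero]

end DescriptorNDS.Dist

end

/-! ### Polynomial solutions, and the dual form of the subspace criterion. -/

noncomputable section

open Polynomial

namespace Matrix

variable {m n p : Type*} [Fintype n]

/-- A polynomial vector with `(s E - A) q(s) = E x₀` and `C q = 0` vanishes if `(E; C)` has trivial
kernel. -/
theorem polynomial_solution_eq_zero {E A : Matrix m n ℝ} {C : Matrix p n ℝ}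
    (hinf : ∀ w : n → ℝ, E.act w = 0 → C.act w = 0 → w = 0) {x₀ : n → ℝ} {q : n → ℝ[X]}
    (hC : C.act q = 0)
    (hE : E.act (fun k => Polynomial.X * q k - Polynomial.C (x₀ k)) = A.act q) : q = 0 := by
  have hC' : ∀ d, C.act (fun k => (q k).coeff d) = 0 := fun d => by
    have := map_act (lcoeff ℝ d) C q
    simp only [lcoeff_apply] at this
    rw [this, hC]
    simp [Pi.zero_def]
  -- Coefficient of degree `d + 1`; the constant `x₀` contributes only in degree `0`.
  have hE' : ∀ d, E.act (fun k => (q k).coeff d) = A.act fun k => (q k).coeff (d + 1) := fun d => by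
    have h1 := map_act (lcoeff ℝ (d + 1)) E (fun k => Polynomial.X * q k - Polynomial.C (x₀ k))
    have h2 := map_act (lcoeff ℝ (d + 1)) A q
    simp only [lcoeff_apply, coeff_sub, coeff_X_mul, coeff_C_succ, sub_zero] at h1 h2
    rw [h1, h2, hE]
  -- Descent from above the maximal degree: if the coefficient of degree `d + 1` vanishes, that of
  -- degree `d` lies in `ker E ∩ ker C`. Here `N` bounds the number of steps still needed.
  have hdesc : ∀ N d, (Finset.univ.sup fun k => (q k).natDegree) < d + N →
      (fun k => (q k).coeff d) = 0 := by
    intro N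
    induction N with
    | zero =>
      intro d hd
      funext k
      exact coeff_eq_zero_of_natDegree_lt
        ((Finset.le_sup (f := fun k => (q k).natDegree) (Finset.mem_univ k)).trans_lt hd)
    | succ N ih =>
      intro d hd
      refine hinf _ ?_ (hC' d)
      rw [hE', ih (d + 1) (by omega), act_zero]
  funext k
  ext d
  exact congrFun (hdesc ((Finset.univ.sup fun k => (q k).natDegree) + 1) d (by omega)) k

/-- The value of a row vector on a vector with entries in a module. -/
def rowAct {V : Type*} [AddCommGroup V] [Module ℝ V] (w : n → V) : (n → ℝ) →ₗ[ℝ] V :=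
  Fintype.linearCombination ℝ w

theorem rowAct_apply {V : Type*} [AddCommGroup V] [Module ℝ V] (w : n → V) (r : n → ℝ) :
    rowAct w r = ∑ k, r k • w k := rfl

theorem rowAct_act [Fintype m] {V : Type*} [AddCommGroup V] [Module ℝ V] (M : Matrix m n ℝ)
    (w : n → V) (r : m → ℝ) : rowAct (M.act w) r = rowAct w (r ᵥ* M) := by
  simp only [rowAct_apply, act, vecMul, dotProduct, Finset.smul_sum, Finset.sum_smul, smul_smul]
  exact Finset.sum_comm

theorem exists_eq_rowAct (f : (n → ℝ) →ₗ[ℝ] ℝ) : ∃ w : n → ℝ, ∀ r, f r = rowAct w r := by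
  classical
  refine ⟨fun k => f (Pi.single k 1), fun r => ?_⟩
  rw [rowAct_apply]
  conv_lhs => rw [pi_eq_sum_univ' r]
  simp [map_sum]

theorem rowAct_comm (w r : n → ℝ) : rowAct w r = rowAct r w := by
  simp only [rowAct_apply, smul_eq_mul, mul_comm]

/-- A subspace `L` of row vectors that contains the rows of `C`, and contains `r A` whenever it
contains `r E`, is everything, under the rank conditions on the pencil. -/
theorem eq_top_of_pencil_closed [Fintype m] {E A : Matrix m n ℝ} {C : Matrix p n ℝ}
    (hinf : ∀ w : n → ℝ, E.act w = 0 → C.act w = 0 → w = 0)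
    (hfin : ∀ (lam : ℂ) (w : n → ℂ), A.act w = lam • E.act w → C.act w = 0 → w = 0)
    {L : Submodule ℝ (n → ℝ)} (hC : ∀ i, C i ∈ L) (hL : ∀ r : m → ℝ, r ᵥ* E ∈ L → r ᵥ* A ∈ L) :
    L = ⊤ := by
  -- The annihilator of `L`; the hypotheses on `L` dualize to `C K = 0` and `A K ⊆ E K`.
  let K : Submodule ℝ (n → ℝ) :=
    { carrier := {w | ∀ r ∈ L, rowAct r w = 0}
      zero_mem' := fun r _ => map_zero _
      add_mem' := fun h h' r hr => by rw [map_add, h r hr, h' r hr, add_zero]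
      smul_mem' := fun c w h r hr => by rw [map_smul, h r hr, smul_zero] }
  have hdual : ∀ r ∉ L, ∃ w ∈ K, rowAct r w ≠ 0 := by
    intro r hr
    obtain ⟨f, hf, hfL⟩ := Submodule.exists_le_ker_of_notMem hr
    obtain ⟨w, hw⟩ := exists_eq_rowAct f
    refine ⟨w, fun r' hr' => ?_, ?_⟩
    · rw [rowAct_comm, ← hw]; exact hfL hr'
    · rwa [rowAct_comm, ← hw]
  have hK : K = ⊥ := by
    refine eq_bot_of_pencil_invariant hinf hfin (E := E) (A := A) (C := C) ?_ ?_
    · intro w hw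
      funext i
      have := hw _ (hC i)
      rwa [rowAct_comm] at this
    · intro w hw
      let EK : Submodule ℝ (m → ℝ) := K.map E.mulVecLin
      by_contra hne
      have hnot : A.act w ∉ EK := by
        rintro ⟨w', hw', h⟩
        exact hne ⟨w', hw', by rw [← h, act_eq_mulVec, mulVecLin_apply]⟩
      -- If `A w ∉ E K`, some row `r` kills `E K` but not `A w`. Then `r E` annihilates `K`, so `r E
      -- ∈ L` by `hdual`, hence `r A ∈ L` and `r A w = 0`, a contradiction.
      obtain ⟨f, hf, hfE⟩ := Submodule.exists_le_ker_of_notMem hnot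
      obtain ⟨r, hr⟩ := exists_eq_rowAct f
      refine hf ?_
      rw [hr, rowAct_comm, rowAct_act, rowAct_comm]
      refine hw _ (hL r ?_)
      by_contra hrE
      obtain ⟨w', hw', hne'⟩ := hdual _ hrE
      refine hne' ?_
      rw [rowAct_comm, ← rowAct_act, rowAct_comm, ← hr, act_eq_mulVec]
      exact hfE ⟨w', hw', rfl⟩
  by_contra htop
  obtain ⟨r, hr⟩ : ∃ r, r ∉ L := by
    by_contra! h
    exact htop (Submodule.eq_top_iff'.2 h)
  obtain ⟨w, hw, hne⟩ := hdual r hr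
  rw [hK, Submodule.mem_bot] at hw
  exact hne (by rw [hw, map_zero])

end Matrix

/-! ### Observability of the network in continuous time. -/

namespace DescriptorNDS

open _root_.DescriptorNDS.Dist

/-- Under the rank conditions, an initial state that admits a distributional solution with zero
output vanishes. -/
theorem initial_state_eq_zero {m n p : Type*} [Fintype m] [Fintype n]
    {E A : Matrix m n ℝ} {C : Matrix p n ℝ}
    (hinf : ∀ w : n → ℝ, E.act w = 0 → C.act w = 0 → w = 0)
    (hfin : ∀ (lam : ℂ) (w : n → ℂ), A.act w = lam • E.act w → C.act w = 0 → w = 0)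
    {x₀ : n → ℝ} {x : n → Dist} (hC₀ : C.act x₀ = 0) (hC : C.act x = 0)
    (hE : E.act (fun k => diff (x k) - x₀ k • (Distribution.delta (0 : ℝ) : Dist)) = A.act x) :
    x₀ = 0 := by
  -- The rows `r` for which `r x` is purely impulsive, that is, of the form `q(∂) δ₀`.
  let L : Submodule ℝ (n → ℝ) := (LinearMap.range impulse).comap (Matrix.rowAct x)
  have hL : L = ⊤ := by
    refine Matrix.eq_top_of_pencil_closed hinf hfin (fun i => ⟨0, ?_⟩) ?_
    · rw [map_zero]; exact (congrFun hC i).symm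
    · rintro r ⟨q, hq⟩
      -- The state equation multiplied by `r` gives `r A x = ∂(r E x) - (r E x₀) δ₀`.
      refine ⟨Polynomial.X * q - Polynomial.C (Matrix.rowAct x₀ (r ᵥ* E)), ?_⟩
      rw [← Matrix.rowAct_act A, ← hE, Matrix.rowAct_act, map_sub, impulse_X_mul, impulse_C, hq]
      simp only [Matrix.rowAct_apply, map_sum, map_smul, smul_sub, Finset.sum_sub_distrib,
        Finset.sum_smul, smul_smul, smul_eq_mul]
  have hx : ∀ k, ∃ q, impulse q = x k := by
    classical
    intro k
    have : Pi.single k 1 ∈ L := hL ▸ Submodule.mem_top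
    obtain ⟨q, hq⟩ := this
    exact ⟨q, by rw [hq, Matrix.rowAct_apply]; simp [Pi.single_apply, ite_smul]⟩
  choose q hq using hx
  have hxq : x = fun k => impulse (q k) := funext fun k => (hq k).symm
  have hqC : C.act q = 0 := by
    refine funext fun i => impulse_injective ?_
    rw [← congrFun (Matrix.map_act impulse C q) i, ← hxq, hC]
    simp
  have hqE : E.act (fun k => Polynomial.X * q k - Polynomial.C (x₀ k)) = A.act q := by
    refine funext fun i => impulse_injective ?_
    rw [← congrFun (Matrix.map_act impulse A q) i, ← hxq, ← hE,
      ← congrFun (Matrix.map_act impulse E _) i]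
    simp only [map_sub, impulse_X_mul, impulse_C, hq]
  have hq0 := Matrix.polynomial_solution_eq_zero hinf hqC hqE
  refine hinf _ ?_ hC₀
  -- The constant coefficient of `X q - x₀` is `-x₀`, so `q = 0` leaves `E x₀ = 0`.
  have h := Matrix.map_act (-(lcoeff ℝ 0)) E (fun k => Polynomial.X * q k - Polynomial.C (x₀ k))
  rw [hqE, hq0, Matrix.act_zero] at h
  simpa [Pi.zero_def] using h

variable {S : DescriptorNDS}

theorem causal_act {m n : Type*} [Fintype n] (M : Matrix m n ℝ) {x : n → Dist}
    (hx : ∀ k, Causal (x k)) (i : m) : Causal (M.act x i) :=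
  causalSubmodule.sum_mem fun k _ => causalSubmodule.smul_mem _ (hx k)

theorem exists_isContinuousTrajectory (hwp : S.WellPosed) {x₀ : S.X → ℝ} {x : S.X → Dist}
    (hx : ∀ k, Causal (x k)) (hC₀ : S.redC.act x₀ = 0) (hC : S.redC.act x = 0)
    (hE : S.E.act (fun k => diff (x k) - x₀ k • (Distribution.delta (0 : ℝ) : Dist)) =
      S.redA.act x) :
    ∃ v₀ z₀ v z, S.IsContinuousTrajectory x₀ 0 v₀ z₀ 0 x 0 v z 0 := by
  have hv := causal_act S.gain hx
  exact ⟨S.gain.act x₀, _, S.gain.act x,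
    (Matrix.blockDiagonal' S.subAzx).act x + (Matrix.blockDiagonal' S.subAzv).act (S.gain.act x),
    { causal_x := hx
      causal_u := fun _ => causalSubmodule.zero_mem
      causal_v := hv
      causal_z := fun k => causalSubmodule.add_mem (causal_act _ hx k) (causal_act _ hv k)
      causal_y := fun _ => causalSubmodule.zero_mem
      algebraic_init := (algebraicEquations_zero_iff hwp _ _ _).2 ⟨rfl, rfl, hC₀⟩
      algebraic := (algebraicEquations_zero_iff hwp _ _ _).2 ⟨rfl, rfl, hC⟩
      state := (stateEquations_zero_iff _ _).2 hE }⟩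

theorem completelyObservable_continuous_iff (hwp : S.WellPosed) :
    S.CompletelyObservable .continuous ↔
      (∀ w : S.X → ℝ, S.E.act w = 0 → S.redC.act w = 0 → w = 0) ∧
      ∀ (lam : ℂ) (w : S.X → ℂ), S.redA.act w = lam • S.E.act w → S.redC.act w = 0 → w = 0 := by
  constructor
  · intro h
    have hzero : ∀ (x₀ : S.X → ℝ) (x : S.X → Dist), (∀ k, Causal (x k)) → S.redC.act x₀ = 0 →
        S.redC.act x = 0 →
        S.E.act (fun k => diff (x k) - x₀ k • (Distribution.delta (0 : ℝ) : Dist)) =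
          S.redA.act x → x₀ = 0 := by
      intro x₀ x hx hC₀ hC hE
      obtain ⟨v₀, z₀, v, z, htraj⟩ := exists_isContinuousTrajectory hwp hx hC₀ hC hE
      obtain ⟨v₀', z₀', v', z', h0⟩ := exists_isContinuousTrajectory (S := S) (x₀ := 0) (x := 0) hwp
        (fun _ => causalSubmodule.zero_mem) (by simp) (by simp) (by
          simp only [Pi.zero_apply, map_zero, zero_smul, sub_zero]
          exact (Matrix.act_zero _).trans (Matrix.act_zero _).symm)
      exact h _ _ _ _ _ _ _ _ _ _ _ _ _ _ _ _ htraj h0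
    refine ⟨fun w hE hC => ?_, fun lam w hA hC => ?_⟩
    -- The state jumps from `w` at `0⁻` to zero: `δ(x) = -w δ₀`, which `E` annihilates.
    · refine hzero w 0 (fun _ => causalSubmodule.zero_mem) hC (by simp) ?_
      have := Matrix.map_act (-(LinearMap.toSpanSingleton ℝ Dist (Distribution.delta (0 : ℝ)))) S.E w
      rw [hE] at this
      simp only [Pi.zero_apply, map_zero, zero_sub]
      rw [Matrix.act_zero]
      simpa [Pi.zero_def] using this
    -- The factor `c` rotates the mode: `c = 1` yields the real part of `w`, and `c = I` its
    -- imaginary part up to sign.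
    · have hre : ∀ (c : ℂ) k, (c * w k).re = 0 := by
        intro c k
        refine congrFun (hzero (fun k => (c * w k).re) (fun k => mode lam (c * w k))
          (fun k => causal_mode _ _) (Matrix.act_mode_eq_zero hC Complex.reLm c)
          (Matrix.act_mode_eq_zero hC (mode lam) c) ?_) k
        simp only [diff_mode, add_sub_cancel_right]
        rw [← Matrix.act_mode hA (mode lam) c]
        refine congrArg _ (funext fun k => ?_)
        ring_nf
      refine funext fun k => Complex.ext (by simpa using hre 1 k) ?_
      simpa using hre Complex.I k
  · rintro ⟨hinf, hfin⟩ x₀ x₀' u₀ v₀ v₀' z₀ z₀' y₀ x x' u v v' z z' y hx hx'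
    have h₀ := hx.algebraic_init.sub hx'.algebraic_init
    have h₁ := hx.algebraic.sub hx'.algebraic
    have h₂ := hx.state.sub hx'.state
    rw [sub_self, sub_self, algebraicEquations_zero_iff hwp] at h₀ h₁
    rw [sub_self, h₁.2.1, stateEquations_zero_iff] at h₂
    refine sub_eq_zero.1 (initial_state_eq_zero hinf hfin h₀.2.2 h₁.2.2 ?_)
    rw [← h₂]
    refine congrArg _ (funext fun k => ?_)
    simp only [Pi.sub_apply, map_sub, sub_smul]
    change diff (x k) - diff (x' k) - _ = (diff (x k) - _) - (diff (x' k) - _)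
    abel

end DescriptorNDS

end

theorem theorem6 (S : DescriptorNDS) (td : TimeDomain)
    (hsub : S.SubsystemsWellPosed) (hwp : S.WellPosed) (hreg : S.IsRegular) :
    S.CompletelyObservable td ↔
      S.MInf.IsFCR ∧ ∀ lam : ℂ, (S.MPencil lam).IsFCR := by
  rw [DescriptorNDS.mInf_isFCR_iff hsub hwp,
    forall_congr' fun lam => DescriptorNDS.mPencil_isFCR_iff hsub hwp lam]
  cases td with
  | continuous => exact DescriptorNDS.completelyObservable_continuous_iff hwp
  | discrete => exact DescriptorNDS.completelyObservable_discrete_iff hwp
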